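/- Let $X$ and $Y$ be real Banach spaces, let $H$ be a compact Hausdorff space, and let $C(H,X)$ and $C(H)=C(H,\mathbb R)$ be the spaces of continuous functions from $H$ to $X$ and to $\mathbb R$, with the supremum norm. Suppose that the dual space $X^*$ has the Radon–Nikodým property: for every finite measure space $(\Omega,\Sigma,\mu)$ and every countably additive $m:\Sigma\to X^*$ of bounded variation that vanishes on all $\mu$-null sets, there is a Bochner $\mu$-integrable $f:\Omega\to X^*$ with $m(A)=\int_A f\,d\mu$ for all $A\in\Sigma$. Let $T:C(H,X)\to Y$ be a bounded linear operator, and let $T^\sharp:C(H)\to L(X,Y)$ be the bounded linear operator given by $T^\sharp(f)(x)=T(xf)$, where $(xf)(h)=f(h)x$ and $L(X,Y)$ is the space of bounded linear operators from $X$ to $Y$ with the operator norm. If $T$ is compact, then $T^\sharp$ is compact. -/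

import Mathlib

open MeasureTheory

universe u v w

/-- The Radon-Nikodym property of a real Banach space `E`: whenever `(Ω, Σ, μ)` is a finite measure
space and `m : Σ → E` is a countably additive vector measure of bounded variation that is absolutely
continuous with respect to `μ`, there is a Bochner integrable `f : Ω → E` such that
`m A = ∫ x in A, f x ∂μ` for all `A ∈ Σ`. The universe of `Ω` is a parameter. -/
def HasRadonNikodymProperty (E : Type u) [NormedAddCommGroup E] [NormedSpace ℝ E]
    [CompleteSpace E] : Prop :=
  ∀ (Ω : Type w) [MeasurableSpace Ω] (μ : Measure Ω) [IsFiniteMeasure μ] (m : VectorMeasure Ω E),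
    m.variation Set.univ < ⊤ →
    (∀ A : Set Ω, MeasurableSet A → μ A = 0 → m A = 0) →
    ∃ f : Ω → E, Integrable f μ ∧ ∀ A : Set Ω, MeasurableSet A → m A = ∫ x in A, f x ∂μ

/-- For `f ∈ C(H)` and `x ∈ X`, the function `x f ∈ C(H, X)` given by `h ↦ f(h) x`. -/
def scalarTimesVector {H X : Type*} [TopologicalSpace H] [NormedAddCommGroup X]
    [NormedSpace ℝ X] (f : C(H, ℝ)) (x : X) : C(H, X) where
  toFun h := f h • x
  continuous_toFun := by fun_prop

theorem norm_scalarTimesVector_le {H X : Type*} [TopologicalSpace H] [CompactSpace H]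
    [NormedAddCommGroup X] [NormedSpace ℝ X] (f : C(H, ℝ)) (x : X) :
    ‖scalarTimesVector f x‖ ≤ ‖f‖ * ‖x‖ := by
  rw [ContinuousMap.norm_le _ (by positivity)]
  intro h
  change ‖f h • x‖ ≤ _
  rw [norm_smul]
  exact mul_le_mul_of_nonneg_right (f.norm_coe_le_norm h) (norm_nonneg x)

/-- The operator `T♯ : C(H) → L(X, Y)` associated with `T : C(H, X) → Y`, that is,
`T♯(f)(x) = T(x f)`. -/
noncomputable def sharp {H X Y : Type*} [TopologicalSpace H] [CompactSpace H]
    [NormedAddCommGroup X] [NormedSpace ℝ X] [NormedAddCommGroup Y] [NormedSpace ℝ Y]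
    (T : C(H, X) →L[ℝ] Y) : C(H, ℝ) →L[ℝ] (X →L[ℝ] Y) :=
  LinearMap.mkContinuous₂
    (LinearMap.mk₂ ℝ (fun (f : C(H, ℝ)) (x : X) => T (scalarTimesVector f x))
      (fun f g x => by
        rw [← map_add]; congr 1; ext h; exact add_smul (f h) (g h) x)
      (fun c f x => by
        rw [← map_smul]; congr 1; ext h; exact mul_smul c (f h) x)
      (fun f x y => by
        rw [← map_add]; congr 1; ext h; exact smul_add (f h) x y)
      (fun c f x => by
        rw [← map_smul]; congr 1; ext h; exact smul_comm (f h) c x))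
    ‖T‖
    (fun f x => by
      rw [LinearMap.mk₂_apply, mul_assoc]
      exact (T.le_opNorm _).trans
        (mul_le_mul_of_nonneg_left (norm_scalarTimesVector_le f x) (norm_nonneg T)))

theorem sharp_apply {H X Y : Type*} [TopologicalSpace H] [CompactSpace H]
    [NormedAddCommGroup X] [NormedSpace ℝ X] [NormedAddCommGroup Y] [NormedSpace ℝ Y]
    (T : C(H, X) →L[ℝ] Y) (f : C(H, ℝ)) (x : X) :
    sharp T f x = T (scalarTimesVector f x) := rfl

/-! Fix `z` in the dual of `Y` and put `φ = z ∘ T`. The variation of `φ` is a positive functional on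
`C(H)`, hence by Riesz–Markov a finite measure `ν`, with `‖φ♯ f‖ ≤ ∫ |f| dν`
(`exists_measure_norm_sharp_le`). So `φ♯` extends to `L¹(ν)`, and the Radon-Nikodym property gives a
Bochner density `g` with `φ♯ f = ∫ f g dν`. Approximating `g` by simple functions makes `φ♯` a norm
limit of finite rank operators, hence compact.

Compactness of `T` then reduces all `z` in the dual ball to finitely many, up to `ε`
(`IsCompactOperator.exists_finite_dual_approx`), so the image of the unit ball under `T♯` is totally
bounded (`isCompactOperator_sharp`). -/

open Filter Topology Metric
open scoped NNReal ENNReal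

/-! ### Operators on `C(H)` with a Bochner density -/

section WeightedIntegral

variable {H : Type*} [TopologicalSpace H] [CompactSpace H] [MeasurableSpace H] [BorelSpace H]
  {E : Type*} [NormedAddCommGroup E] [NormedSpace ℝ E]

theorem ContinuousMap.integrable_of_isFiniteMeasure (ν : Measure H) [IsFiniteMeasure ν]
    (f : C(H, ℝ)) : Integrable f ν :=
  .of_bound f.continuous.aestronglyMeasurable ‖f‖ (.of_forall f.norm_coe_le_norm)

theorem ContinuousMap.norm_toLp_one (ν : Measure H) [IsFiniteMeasure ν] (f : C(H, ℝ)) :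
    ‖ContinuousMap.toLp 1 ν ℝ f‖ = ∫ h, ‖f h‖ ∂ν := by
  rw [L1.norm_eq_integral_norm]
  refine integral_congr_ae ?_
  filter_upwards [ContinuousMap.coeFn_toLp (p := 1) (𝕜 := ℝ) ν f] with h hh
  rw [hh]

variable [CompleteSpace E] (ν : Measure H) [IsFiniteMeasure ν]

/-- The operator `f ↦ ∫ f g dν` on `C(H)` with density `g ∈ L¹(ν; E)`, as a function of `g`. -/
noncomputable def weightedIntegral : Lp E 1 ν →L[ℝ] C(H, ℝ) →L[ℝ] E :=
  ((ContinuousMap.toLp ∞ ν ℝ : C(H, ℝ) →L[ℝ] Lp ℝ ∞ ν).precomp E) ∘L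
    (ContinuousLinearMap.lsmul ℝ ℝ : ℝ →L[ℝ] E →L[ℝ] E).flip.lpPairing ν 1 ∞

theorem weightedIntegral_apply (g : Lp E 1 ν) (f : C(H, ℝ)) :
    weightedIntegral ν g f = ∫ h, f h • g h ∂ν := by
  change ContinuousLinearMap.lpPairing ν 1 ∞ (ContinuousLinearMap.lsmul ℝ ℝ).flip g
    (ContinuousMap.toLp ∞ ν ℝ f) = _
  rw [ContinuousLinearMap.lpPairing_eq_integral]
  refine integral_congr_ae ?_
  filter_upwards [ContinuousMap.coeFn_toLp (p := ∞) (𝕜 := ℝ) ν f] with h hh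
  rw [ContinuousLinearMap.flip_apply, ContinuousLinearMap.lsmul_apply, hh]

theorem weightedIntegral_indicatorConstLp {s : Set H} (hs : MeasurableSet s) (c : E)
    (f : C(H, ℝ)) :
    weightedIntegral ν (indicatorConstLp 1 hs (measure_ne_top ν s) c) f =
      (∫ h in s, f h ∂ν) • c := by
  rw [weightedIntegral_apply, ← integral_smul_const, ← integral_indicator hs]
  refine integral_congr_ae ?_
  filter_upwards [indicatorConstLp_coeFn (p := 1) (hs := hs) (hμs := measure_ne_top ν s)
    (c := c)] with h hh
  rw [hh]
  by_cases hhs : h ∈ s <;> simp [hhs]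

/-- An indicator density gives rank at most one, and compact operators form a norm-closed set, so
density of simple functions in `L¹` suffices. -/
theorem isCompactOperator_weightedIntegral (g : Lp E 1 ν) :
    IsCompactOperator (weightedIntegral ν g) := by
  refine Lp.induction (p := 1) ENNReal.one_ne_top
    (motive := fun g => IsCompactOperator (weightedIntegral ν g)) ?_ ?_ ?_ g
  · intro c s hs hνs
    rw [Lp.simpleFunc.coe_indicatorConst]
    have h : (weightedIntegral ν (indicatorConstLp 1 hs hνs.ne c) : C(H, ℝ) → E) =
        ContinuousLinearMap.toSpanSingleton ℝ c ∘
          weightedIntegral ν (indicatorConstLp 1 hs hνs.ne (1 : ℝ)) := by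
      ext f
      simp [weightedIntegral_indicatorConstLp]
    rw [h]
    exact (isCompactOperator_of_locallyCompactSpace_dom
      (weightedIntegral ν (indicatorConstLp 1 hs hνs.ne (1 : ℝ)))).clm_comp _
  · intro f g hf hg _ hf' hg'
    rw [map_add]
    exact hf'.add hg'
  · exact isClosed_setOfPred_isCompactOperator.preimage (weightedIntegral ν).continuous

end WeightedIntegral

/-! ### Vector measures and densities of operators on `L¹` -/

section Density

variable {Ω : Type*} [MeasurableSpace Ω] {ν : Measure Ω} [IsFiniteMeasure ν]
  {E : Type*} [NormedAddCommGroup E] [NormedSpace ℝ E]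

theorem enorm_apply_indicatorConstLp_le {L : Lp ℝ 1 ν →L[ℝ] E} (hL : ‖L‖ ≤ 1) {s : Set Ω}
    (hs : MeasurableSet s) : ‖L (indicatorConstLp 1 hs (measure_ne_top ν s) 1)‖ₑ ≤ ν s :=
  calc ‖L (indicatorConstLp 1 hs (measure_ne_top ν s) 1)‖ₑ
      ≤ ‖indicatorConstLp 1 hs (measure_ne_top ν s) (1 : ℝ)‖ₑ := by
        rw [enorm_le_iff_norm_le]
        exact L.le_of_opNorm_le_of_le hL le_rfl |>.trans_eq (one_mul _)
    _ ≤ ν s := enorm_indicatorConstLp_le.trans_eq (by simp)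

open Classical in
/-- The vector measure `A ↦ L (1_A)` of a contraction `L : L¹(ν) → E`. -/
noncomputable def vectorMeasureOfL1 (L : Lp ℝ 1 ν →L[ℝ] E) (hL : ‖L‖ ≤ 1) : VectorMeasure Ω E :=
  VectorMeasure.of_additive_of_le_measure (μ := ν)
    (fun s => if hs : MeasurableSet s then L (indicatorConstLp 1 hs (measure_ne_top ν s) 1) else 0)
    (fun s => by
      by_cases hs : MeasurableSet s
      · simpa only [hs, dite_true] using enorm_apply_indicatorConstLp_le hL hs
      · simp [hs])
    (fun s t hs ht hst => by
      simp only [hs, ht, hs.union ht, dite_true]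
      rw [← map_add, ← indicatorConstLp_disjoint_union hs ht _ _ hst])
    (fun s hs => by simp [hs])

theorem vectorMeasureOfL1_apply (L : Lp ℝ 1 ν →L[ℝ] E) (hL : ‖L‖ ≤ 1) {s : Set Ω}
    (hs : MeasurableSet s) :
    vectorMeasureOfL1 L hL s = L (indicatorConstLp 1 hs (measure_ne_top ν s) 1) := by
  classical
  change (if hs : MeasurableSet s then L (indicatorConstLp 1 hs (measure_ne_top ν s) 1) else 0) = _
  simp [hs]

theorem enorm_vectorMeasureOfL1_le (L : Lp ℝ 1 ν →L[ℝ] E) (hL : ‖L‖ ≤ 1) {s : Set Ω}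
    (hs : MeasurableSet s) : ‖vectorMeasureOfL1 L hL s‖ₑ ≤ ν s := by
  rw [vectorMeasureOfL1_apply L hL hs]
  exact enorm_apply_indicatorConstLp_le hL hs

/-- If `L (1_A) = ∫_A g dν` for all measurable `A`, then `L f = ∫ f g dν` for bounded `f`. -/
theorem eq_integral_smul_of_indicator (L : Lp ℝ 1 ν →L[ℝ] E) {g : Ω → E} (hg : Integrable g ν)
    (hLg : ∀ (s : Set Ω) (hs : MeasurableSet s),
      L (indicatorConstLp 1 hs (measure_ne_top ν s) 1) = ∫ x in s, g x ∂ν)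
    {f : Ω → ℝ} (hf : Measurable f) {C : ℝ} (hC : ∀ x, ‖f x‖ ≤ C) (hfL : MemLp f 1 ν) :
    L (hfL.toLp f) = ∫ x, f x • g x ∂ν := by
  have hsmul (s : SimpleFunc Ω ℝ) : Integrable (fun x => s x • g x) ν := by
    obtain ⟨D, hD⟩ := s.exists_forall_norm_le
    exact hg.bdd_smul D s.aestronglyMeasurable (.of_forall hD)
  have hsimple (s : SimpleFunc Ω ℝ) : ∀ hs : MemLp s 1 ν, L (hs.toLp s) = ∫ x, s x • g x ∂ν := by
    induction s using SimpleFunc.induction with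
    | const c hA =>
      rename_i A
      intro hs
      have h1 : hs.toLp _ = c • indicatorConstLp 1 hA (measure_ne_top ν A) (1 : ℝ) := by
        rw [indicatorConstLp, ← MemLp.toLp_const_smul]
        refine MemLp.toLp_congr _ _ (.of_forall fun x => ?_)
        by_cases hx : x ∈ A <;> simp [hx]
      rw [h1, map_smul, hLg, ← integral_smul, ← integral_indicator hA]
      refine integral_congr_ae (.of_forall fun x => ?_)
      by_cases hx : x ∈ A <;> simp [hx]
    | add _ h₁ h₂ =>
      rename_i f₁ f₂ _
      intro hs
      have hf₁ : MemLp f₁ 1 ν := SimpleFunc.memLp_of_isFiniteMeasure f₁ 1 ν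
      have hf₂ : MemLp f₂ 1 ν := SimpleFunc.memLp_of_isFiniteMeasure f₂ 1 ν
      have h : hs.toLp _ = hf₁.toLp f₁ + hf₂.toLp f₂ := by
        rw [← MemLp.toLp_add]; rfl
      rw [h, map_add, h₁, h₂, ← integral_add (hsmul f₁) (hsmul f₂)]
      simp [add_smul]
  have h1 := (L.continuous.tendsto _).comp
    (SimpleFunc.tendsto_approxOn_range_Lp (p := 1) ENNReal.one_ne_top hf hfL)
  refine tendsto_nhds_unique h1 ?_
  simp only [Function.comp_def, hsimple]
  -- The approximants are only bounded by `‖f x‖ + ‖f x‖`, hence `C + C`.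
  refine tendsto_integral_of_dominated_convergence (fun x => (C + C) * ‖g x‖)
    (fun n => (hsmul _).aestronglyMeasurable) (hg.norm.const_mul _)
    (fun n => .of_forall fun x => ?_) (.of_forall fun x => ?_)
  · rw [norm_smul]
    gcongr
    exact (SimpleFunc.norm_approxOn_zero_le hf _ x n).trans (add_le_add (hC x) (hC x))
  · exact (SimpleFunc.tendsto_approxOn hf _ (subset_closure (by simp))).smul_const _

end Density

/-- An operator on `C(H)` dominated by an `L¹` norm, with values in a space with the Radon-Nikodym
property, is compact. -/
theorem HasRadonNikodymProperty.isCompactOperator_of_norm_le_integral {H : Type w}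
    [TopologicalSpace H] [CompactSpace H] [T2Space H] [MeasurableSpace H] [BorelSpace H]
    {E : Type u} [NormedAddCommGroup E] [NormedSpace ℝ E] [CompleteSpace E]
    (hE : HasRadonNikodymProperty.{u, w} E) (ν : Measure H) [IsFiniteMeasure ν] [ν.WeaklyRegular]
    (S : C(H, ℝ) →L[ℝ] E) (hS : ∀ f, ‖S f‖ ≤ ∫ h, ‖f h‖ ∂ν) : IsCompactOperator S := by
  have hdense : DenseRange (ContinuousMap.toLp 1 ν ℝ : C(H, ℝ) →L[ℝ] Lp ℝ 1 ν).toLinearMap :=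
    ContinuousMap.toLp_denseRange ℝ ν ℝ ENNReal.one_ne_top
  have hbound (f : C(H, ℝ)) : ‖S.toLinearMap f‖ ≤
      1 * ‖(ContinuousMap.toLp 1 ν ℝ : C(H, ℝ) →L[ℝ] Lp ℝ 1 ν).toLinearMap f‖ := by
    rw [one_mul]
    exact (hS f).trans_eq (ContinuousMap.norm_toLp_one ν f).symm
  set L := S.toLinearMap.extendOfNorm
    (ContinuousMap.toLp 1 ν ℝ : C(H, ℝ) →L[ℝ] Lp ℝ 1 ν).toLinearMap
  have hL : ‖L‖ ≤ 1 := LinearMap.opNorm_extendOfNorm_le hdense zero_le_one hbound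
  have hLS (f : C(H, ℝ)) : L (ContinuousMap.toLp 1 ν ℝ f) = S f :=
    LinearMap.extendOfNorm_eq hdense ⟨1, hbound⟩ f
  -- The single bound `‖L 1_A‖ ≤ ν A` gives both bounded variation and absolute continuity.
  obtain ⟨g, hg, hmg⟩ := hE H ν (vectorMeasureOfL1 L hL)
    (((VectorMeasure.variation_le_of_forall_enorm_le
      (fun A hA => enorm_vectorMeasureOfL1_le L hL hA)) Set.univ).trans_lt (measure_lt_top ν _))
    (fun A hA h0 => by
      have := enorm_vectorMeasureOfL1_le L hL hA
      rwa [h0, nonpos_iff_eq_zero, enorm_eq_zero] at this)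
  have hg1 : MemLp g 1 ν := memLp_one_iff_integrable.2 hg
  have hSg : S = weightedIntegral ν (hg1.toLp g) := by
    ext f
    rw [weightedIntegral_apply, ← hLS]
    have hf1 : MemLp f 1 ν := memLp_one_iff_integrable.2 (f.integrable_of_isFiniteMeasure ν)
    have hf2 : ContinuousMap.toLp 1 ν ℝ f = hf1.toLp f := by
      ext1
      exact (ContinuousMap.coeFn_toLp ν f).trans hf1.coeFn_toLp.symm
    rw [hf2, eq_integral_smul_of_indicator L hg
      (fun s hs => by rw [← hmg s hs, vectorMeasureOfL1_apply L hL hs])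
      f.continuous.measurable f.norm_coe_le_norm]
    refine integral_congr_ae ?_
    filter_upwards [hg1.coeFn_toLp] with h hh
    rw [hh]
  rw [hSg]
  exact isCompactOperator_weightedIntegral ν _

/-! ### The variation of a functional on `C(H, X)` -/

section DominatingFunctional

open scoped CompactlySupported

variable {H X : Type*} [TopologicalSpace H] [NormedAddCommGroup X] [NormedSpace ℝ X]

/-- The supremum of `φ F` over all `F ∈ C(H, X)` with `‖F‖ ≤ f` pointwise. -/
noncomputable def dominatedSup (φ : StrongDual ℝ C(H, X)) (f : C_c(H, ℝ≥0)) : ℝ :=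
  ⨆ F : {F : C(H, X) // ∀ h, ‖F h‖ ≤ f h}, φ F

theorem dominatedSup_le {φ : StrongDual ℝ C(H, X)} {f : C_c(H, ℝ≥0)} {c : ℝ}
    (hc : ∀ F : C(H, X), (∀ h, ‖F h‖ ≤ f h) → φ F ≤ c) : dominatedSup φ f ≤ c :=
  haveI : Nonempty {F : C(H, X) // ∀ h, ‖F h‖ ≤ f h} := ⟨⟨0, by simp⟩⟩
  ciSup_le fun F => hc F F.2

/-- Riesz decomposition: weight `F` by `f / (f + g)` and `g / (f + g)`. Where `f + g = 0` the
function `F` vanishes, and since the weights are at most `1` the products are continuous there too.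
-/
theorem exists_add_eq_of_norm_le_add {F : C(H, X)} {f g : C_c(H, ℝ≥0)}
    (hF : ∀ h, ‖F h‖ ≤ f h + g h) :
    ∃ F₁ F₂ : C(H, X), (∀ h, ‖F₁ h‖ ≤ f h) ∧ (∀ h, ‖F₂ h‖ ≤ g h) ∧ F₁ + F₂ = F := by
  have hle (p q : C_c(H, ℝ≥0)) (h : H) : ((p h / (p h + q h) : ℝ≥0) : ℝ) ≤ 1 := by
    exact_mod_cast div_le_one_of_le₀ le_self_add zero_le
  have hcont (p q : C_c(H, ℝ≥0)) (hpq : ∀ h, ‖F h‖ ≤ p h + q h) :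
      Continuous fun h => ((p h / (p h + q h) : ℝ≥0) : ℝ) • F h := by
    refine continuous_iff_continuousAt.2 fun h₀ => ?_
    by_cases h0 : p h₀ + q h₀ = 0
    · have hF0 : F h₀ = 0 := norm_le_zero_iff.1 ((hpq h₀).trans_eq (by exact_mod_cast h0))
      have hlim : Tendsto (fun h => ‖F h‖) (𝓝 h₀) (𝓝 0) := by
        simpa [hF0] using (F.continuous.tendsto h₀).norm
      rw [ContinuousAt, hF0, smul_zero]
      refine squeeze_zero_norm (fun h => ?_) hlim
      rw [norm_smul, Real.norm_of_nonneg (NNReal.coe_nonneg _)]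
      exact mul_le_of_le_one_left (norm_nonneg _) (hle p q h)
    · have hp := p.continuous.continuousAt (x := h₀)
      have hq := q.continuous.continuousAt (x := h₀)
      exact (NNReal.continuous_coe.continuousAt.comp (hp.div (hp.add hq) h0)).smul
        F.continuous.continuousAt
  have hnorm (p q : C_c(H, ℝ≥0)) (hpq : ∀ h, ‖F h‖ ≤ p h + q h) (h : H) :
      ‖((p h / (p h + q h) : ℝ≥0) : ℝ) • F h‖ ≤ p h := by
    rw [norm_smul, Real.norm_of_nonneg (NNReal.coe_nonneg _)]
    refine (mul_le_mul_of_nonneg_left (hpq h) (NNReal.coe_nonneg _)).trans ?_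
    norm_cast
    rcases eq_or_ne (p h + q h) 0 with h0 | h0
    · simp [h0]
    · exact (div_mul_cancel₀ _ h0).le
  have hF' : ∀ h, ‖F h‖ ≤ g h + f h := fun h => (hF h).trans_eq (add_comm _ _)
  refine ⟨⟨_, hcont f g hF⟩, ⟨_, hcont g f hF'⟩, hnorm f g hF, hnorm g f hF', ?_⟩
  ext h
  change ((f h / (f h + g h) : ℝ≥0) : ℝ) • F h + ((g h / (g h + f h) : ℝ≥0) : ℝ) • F h = F h
  by_cases h0 : f h + g h = 0
  · have hF0 : F h = 0 := norm_le_zero_iff.1 ((hF h).trans_eq (by exact_mod_cast h0))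
    simp [hF0]
  · rw [← add_smul, ← NNReal.coe_add, add_comm (g h), ← add_div, div_self h0, NNReal.coe_one,
      one_smul]

variable [CompactSpace H]

theorem bddAbove_dominated (φ : StrongDual ℝ C(H, X)) (f : C_c(H, ℝ≥0)) :
    BddAbove (Set.range fun F : {F : C(H, X) // ∀ h, ‖F h‖ ≤ f h} => φ F) := by
  obtain ⟨C, hC⟩ := (isCompact_range f.continuous).bddAbove
  refine ⟨‖φ‖ * C, ?_⟩
  rintro _ ⟨F, rfl⟩
  refine (le_abs_self _).trans (φ.le_of_opNorm_le_of_le le_rfl ?_)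
  exact (ContinuousMap.norm_le _ C.2).2 fun h => (F.2 h).trans (hC ⟨h, rfl⟩)

theorem le_dominatedSup (φ : StrongDual ℝ C(H, X)) {f : C_c(H, ℝ≥0)} {F : C(H, X)}
    (hF : ∀ h, ‖F h‖ ≤ f h) : φ F ≤ dominatedSup φ f :=
  le_ciSup (bddAbove_dominated φ f) ⟨F, hF⟩

theorem dominatedSup_nonneg (φ : StrongDual ℝ C(H, X)) (f : C_c(H, ℝ≥0)) :
    0 ≤ dominatedSup φ f := by
  simpa using le_dominatedSup φ (f := f) (F := 0) (by simp)

theorem dominatedSup_add (φ : StrongDual ℝ C(H, X)) (f g : C_c(H, ℝ≥0)) :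
    dominatedSup φ (f + g) = dominatedSup φ f + dominatedSup φ g := by
  refine le_antisymm (dominatedSup_le fun F hF => ?_) ?_
  · obtain ⟨F₁, F₂, h₁, h₂, rfl⟩ := exists_add_eq_of_norm_le_add (f := f) (g := g)
      (fun h => by simpa using hF h)
    rw [map_add]
    exact add_le_add (le_dominatedSup φ h₁) (le_dominatedSup φ h₂)
  · rw [← le_sub_iff_add_le]
    refine dominatedSup_le fun F hF => ?_
    rw [le_sub_comm]
    refine dominatedSup_le fun G hG => ?_
    rw [le_sub_iff_add_le, ← map_add]
    refine le_dominatedSup φ fun h => ?_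
    rw [add_comm f]
    simpa using norm_add_le_of_le (hG h) (hF h)

theorem dominatedSup_smul (φ : StrongDual ℝ C(H, X)) (c : ℝ≥0) (f : C_c(H, ℝ≥0)) :
    dominatedSup φ (c • f) = c * dominatedSup φ f := by
  rcases eq_or_ne c 0 with rfl | hc
  -- Additivity at `0 + 0` forces the value at `0` to be `0`.
  · have h := dominatedSup_add φ 0 0
    rw [add_zero, left_eq_add] at h
    simpa using h
  have key (c : ℝ≥0) (hc : c ≠ 0) (f : C_c(H, ℝ≥0)) :
      c * dominatedSup φ f ≤ dominatedSup φ (c • f) := by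
    rw [← le_div_iff₀' (by positivity)]
    refine dominatedSup_le fun F hF => ?_
    rw [le_div_iff₀' (by positivity), ← smul_eq_mul, ← map_smul]
    refine le_dominatedSup φ fun h => ?_
    rw [ContinuousMap.smul_apply, norm_smul, NNReal.norm_eq]
    simpa using mul_le_mul_of_nonneg_left (hF h) c.2
  refine le_antisymm ?_ (key c hc f)
  have h := key c⁻¹ (inv_ne_zero hc) (c • f)
  rw [smul_smul, inv_mul_cancel₀ hc, one_smul, NNReal.coe_inv,
    inv_mul_le_iff₀ (by positivity)] at h
  exact h

/-- The positive functional on `C(H)` dominating a functional on `C(H, X)`. -/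
noncomputable def dominatingFunctional (φ : StrongDual ℝ C(H, X)) :
    C_c(H, ℝ≥0) →ₗ[ℝ≥0] ℝ≥0 where
  toFun f := ⟨dominatedSup φ f, dominatedSup_nonneg φ f⟩
  map_add' f g := NNReal.eq (dominatedSup_add φ f g)
  map_smul' c f := NNReal.eq (dominatedSup_smul φ c f)

/-- The function `x f` competes in the supremum for `‖x‖ p`, and homogeneity extracts `‖x‖`; using
`-x` as well handles the absolute value. -/
theorem norm_sharp_le_dominatedSup (φ : StrongDual ℝ C(H, X)) {f : C(H, ℝ)} {p : C_c(H, ℝ≥0)}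
    (hp : ∀ h, ‖f h‖ ≤ p h) : ‖sharp φ f‖ ≤ dominatedSup φ p := by
  refine ContinuousLinearMap.opNorm_le_bound _ (dominatedSup_nonneg φ p) fun x => ?_
  have key (y : X) (hy : ‖y‖ = ‖x‖) : φ (scalarTimesVector f y) ≤ dominatedSup φ p * ‖x‖ := by
    have h : φ (scalarTimesVector f y) ≤ dominatedSup φ (‖x‖₊ • p) := by
      refine le_dominatedSup φ fun h => ?_
      change ‖f h • y‖ ≤ _
      rw [norm_smul, hy, mul_comm]
      simpa using mul_le_mul_of_nonneg_left (hp h) (norm_nonneg x)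
    rwa [dominatedSup_smul, mul_comm] at h
  rw [sharp_apply, Real.norm_eq_abs, abs_le']
  refine ⟨key x rfl, ?_⟩
  have hneg : -φ (scalarTimesVector f x) = φ (scalarTimesVector f (-x)) := by
    rw [← sharp_apply, ← sharp_apply, map_neg]
  rw [hneg]
  exact key (-x) (norm_neg x)

theorem exists_measure_norm_sharp_le [T2Space H] [MeasurableSpace H] [BorelSpace H]
    (φ : StrongDual ℝ C(H, X)) :
    ∃ ν : Measure H, IsFiniteMeasure ν ∧ ν.WeaklyRegular ∧
      ∀ f : C(H, ℝ), ‖sharp φ f‖ ≤ ∫ h, ‖f h‖ ∂ν := by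
  refine ⟨NNRealRMK.rieszMeasure (dominatingFunctional φ), inferInstance, inferInstance,
    fun f => ?_⟩
  let p : C_c(H, ℝ≥0) :=
    CompactlySupportedContinuousMap.continuousMapEquiv ⟨fun h => ‖f h‖₊, by fun_prop⟩
  have h := NNRealRMK.integral_rieszMeasure (dominatingFunctional φ) p
  exact (norm_sharp_le_dominatedSup φ (p := p) fun h => le_rfl).trans_eq h.symm

end DominatingFunctional

theorem isCompactOperator_sharp_of_strongDual {H : Type w} [TopologicalSpace H] [CompactSpace H]
    [T2Space H] {X : Type u} [NormedAddCommGroup X] [NormedSpace ℝ X]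
    (hX : HasRadonNikodymProperty.{u, w} (StrongDual ℝ X)) (φ : StrongDual ℝ C(H, X)) :
    IsCompactOperator (sharp φ) := by
  borelize H
  obtain ⟨ν, _, _, hν⟩ := exists_measure_norm_sharp_le φ
  exact hX.isCompactOperator_of_norm_le_integral ν (sharp φ) hν

/-! ### Total boundedness: from functionals to operators -/

theorem exists_finite_forall_dist_lt {ι E : Type*} {F : ι → Type*} [Fintype ι]
    [∀ i, PseudoMetricSpace (F i)] (Φ : ∀ i, E → F i) {s : Set E}
    (hs : ∀ i, ∃ K, IsCompact K ∧ Φ i '' s ⊆ K) {ε : ℝ} (hε : 0 < ε) :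
    ∃ t ⊆ s, t.Finite ∧ ∀ x ∈ s, ∃ y ∈ t, ∀ i, dist (Φ i x) (Φ i y) < ε := by
  choose K hK hsK using hs
  have htb : TotallyBounded ((fun x i => Φ i x) '' s) := by
    refine (isCompact_univ_pi hK).totallyBounded.subset ?_
    rintro _ ⟨x, hx, rfl⟩ i _
    exact hsK i ⟨x, hx, rfl⟩
  obtain ⟨u, hus, huf, hu⟩ := finite_approx_of_totallyBounded htb ε hε
  obtain ⟨t, hts, htf, rfl⟩ := Set.exists_subset_image_finite_and.1 ⟨u, hus, huf, rfl⟩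
  refine ⟨t, hts, htf, fun x hx => ?_⟩
  obtain ⟨_, ⟨y, hy, rfl⟩, hxy⟩ := Set.mem_iUnion₂.1 (hu ⟨x, hx, rfl⟩)
  exact ⟨y, hy, (dist_pi_lt_iff hε).1 hxy⟩

/-- The adjoint of a compact operator maps the dual unit ball to a totally bounded set. -/
theorem IsCompactOperator.exists_finite_dual_approx {E Y : Type*} [NormedAddCommGroup E]
    [NormedSpace ℝ E] [NormedAddCommGroup Y] [NormedSpace ℝ Y] {T : E →L[ℝ] Y}
    (hT : IsCompactOperator T) {ε : ℝ} (hε : 0 < ε) :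
    ∃ t : Set (StrongDual ℝ Y), t.Finite ∧ ∀ z : StrongDual ℝ Y, ‖z‖ ≤ 1 →
      ∃ w ∈ t, ∀ x : E, ‖x‖ ≤ 1 → |z (T x) - w (T x)| ≤ ε := by
  obtain ⟨K, hK, hTK⟩ := IsCompactOperator.image_closedBall_subset_compact
    (f := T.toLinearMap) hT 1
  obtain ⟨s, hsK, hsf, hs⟩ := finite_approx_of_totallyBounded hK.totallyBounded (ε / 3)
    (by positivity)
  have := hsf.fintype
  -- Functionals are compared only at the finitely many net points `y`, where the dual ball takes
  -- values in a compact interval.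
  obtain ⟨t, ht1, htf, ht⟩ := exists_finite_forall_dist_lt
    (fun (y : s) (z : StrongDual ℝ Y) => z y) (s := closedBall 0 1)
    (fun y => ⟨closedBall 0 ‖(y : Y)‖, isCompact_closedBall _ _, by
      rintro _ ⟨z, hz, rfl⟩
      rw [mem_closedBall_zero_iff] at hz ⊢
      exact (z.le_of_opNorm_le hz _).trans_eq (one_mul _)⟩)
    (show 0 < ε / 3 by positivity)
  refine ⟨t, htf, fun z hz => ?_⟩
  obtain ⟨w, hwt, hw⟩ := ht z (mem_closedBall_zero_iff.2 hz)
  refine ⟨w, hwt, fun x hx => ?_⟩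
  obtain ⟨y, hy, hxy⟩ := Set.mem_iUnion₂.1
    (hs (hTK ⟨x, mem_closedBall_zero_iff.2 hx, rfl⟩))
  have hxy' : ‖T x - y‖ ≤ ε / 3 := (mem_ball_iff_norm.1 hxy).le
  have h1 := z.le_of_opNorm_le_of_le hz hxy'
  have h2 := w.le_of_opNorm_le_of_le (mem_closedBall_zero_iff.1 (ht1 hwt)) hxy'
  have h3 : |z y - w y| < ε / 3 := hw ⟨y, hy⟩
  rw [map_sub, Real.norm_eq_abs, abs_le] at h1 h2
  rw [abs_lt] at h3
  rw [abs_le]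
  constructor <;> linarith

theorem sharp_strongDual_comp {H X Y : Type*} [TopologicalSpace H] [CompactSpace H]
    [NormedAddCommGroup X] [NormedSpace ℝ X] [NormedAddCommGroup Y] [NormedSpace ℝ Y]
    (z : StrongDual ℝ Y) (T : C(H, X) →L[ℝ] Y) (f : C(H, ℝ)) (x : X) :
    sharp (z ∘L T) f x = z (sharp T f x) := rfl

theorem isCompactOperator_sharp {H X Y : Type*} [TopologicalSpace H] [CompactSpace H]
    [NormedAddCommGroup X] [NormedSpace ℝ X] [NormedAddCommGroup Y] [NormedSpace ℝ Y]
    [CompleteSpace Y] {T : C(H, X) →L[ℝ] Y} (hT : IsCompactOperator T)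
    (hdual : ∀ z : StrongDual ℝ Y, IsCompactOperator (sharp (z ∘L T))) :
    IsCompactOperator (sharp T) := by
  refine (isCompactOperator_iff_isCompact_closure_image_closedBall
    (sharp T).toLinearMap one_pos).2 ?_
  refine TotallyBounded.isCompact_of_isClosed (TotallyBounded.closure ?_) isClosed_closure
  rw [Metric.totallyBounded_iff]
  intro ε hε
  obtain ⟨t, htf, ht⟩ := hT.exists_finite_dual_approx (show 0 < ε / 4 by positivity)
  have := htf.fintype
  obtain ⟨u, hu1, huf, hu⟩ := exists_finite_forall_dist_lt
    (fun (z : t) (f : C(H, ℝ)) => sharp ((z : StrongDual ℝ Y) ∘L T) f) (s := closedBall 0 1)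
    (fun z => IsCompactOperator.image_closedBall_subset_compact
      (f := (sharp ((z : StrongDual ℝ Y) ∘L T)).toLinearMap) (hdual z) 1)
    (show 0 < ε / 4 by positivity)
  refine ⟨sharp T '' u, huf.image _, ?_⟩
  rintro _ ⟨f, hf, rfl⟩
  obtain ⟨g, hg, hfg⟩ := hu f hf
  refine Set.mem_iUnion₂.2 ⟨sharp T g, ⟨g, hg, rfl⟩, ?_⟩
  rw [mem_ball_iff_norm]
  change ‖sharp T f - sharp T g‖ < ε
  refine (ContinuousLinearMap.opNorm_le_of_unit_norm (C := 3 * (ε / 4)) (by positivity)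
    fun x hx => ?_).trans_lt (by linarith)
  -- The norming `z` depends on `f`, `g` and `x`, but its substitute `w` lies in the finite set `t`.
  -- Exchanging `z` for `w` at `f` and at `g`, then comparing `f` with `g` under `w`, costs `ε / 4`
  -- each.
  obtain ⟨z, hz, hzx⟩ := exists_dual_vector'' ℝ ((sharp T f - sharp T g) x)
  obtain ⟨w, hw, hzw⟩ := ht z hz
  have hle {k : C(H, ℝ)} (hk : k ∈ closedBall 0 1) : ‖scalarTimesVector k x‖ ≤ 1 :=
    (norm_scalarTimesVector_le k x).trans (by simpa [hx] using hk)
  have h1 : |z (sharp T f x) - w (sharp T f x)| ≤ ε / 4 := hzw _ (hle hf)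
  have h2 : |z (sharp T g x) - w (sharp T g x)| ≤ ε / 4 := hzw _ (hle (hu1 hg))
  have h3 := (sharp (w ∘L T) f - sharp (w ∘L T) g).le_of_opNorm_le_of_le
    (mem_ball_iff_norm.1 (hfg ⟨w, hw⟩)).le hx.le
  rw [sub_apply, sharp_strongDual_comp, sharp_strongDual_comp, Real.norm_eq_abs] at h3
  have hzx' : z (sharp T f x) - z (sharp T g x) = ‖(sharp T f - sharp T g) x‖ := by
    rw [← map_sub]
    exact hzx
  rw [← hzx']
  rw [abs_le] at h1 h2 h3
  linarith

theorem corollary6 {H : Type w} [TopologicalSpace H] [CompactSpace H] [T2Space H]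
    {X : Type u} [NormedAddCommGroup X] [NormedSpace ℝ X] [CompleteSpace X]
    {Y : Type v} [NormedAddCommGroup Y] [NormedSpace ℝ Y] [CompleteSpace Y]
    (hX : HasRadonNikodymProperty.{u, w} (StrongDual ℝ X))
    (T : C(H, X) →L[ℝ] Y) (hT : IsCompactOperator T) :
    IsCompactOperator (sharp T) :=
  isCompactOperator_sharp hT fun z => isCompactOperator_sharp_of_strongDual hX (z ∘L T)
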